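/- Let $\delta \ge 0$ and $n \ge \delta+1$. Put $\xi_t=(1,t,\dots,t^{k-1})\in\mathbb R^k$ and $p_t=(t,t^2,\dots,t^k)\in\mathbb R^k$. Let $Z(n,k)=\overline{\mathbf 0\xi_1}+\dots+\overline{\mathbf 0\xi_n}\subset\mathbb R^k$ be the cyclic zonotope, and let $C(n,k)=\mathrm{conv}(p_1,\dots,p_n)\subset\mathbb R^k$ be the cyclic polytope. Let $\pi_{k,l}\colon\mathbb R^k\to\mathbb R^l$ be the projection to the first $l$ coordinates, and call a union of faces of a polytope a subcomplex of it. A cubillage of $Z(n,\delta+1)$ is a subcomplex $\mathcal Q$ of $Z(n,n)$ such that $\pi_{n,\delta+1}\colon\mathcal Q\to Z(n,\delta+1)$ is a bijection. A triangulation of $C(n,\delta)$ is a subcomplex $\mathcal T$ of $C(n,n-1)$ such that $\pi_{n-1,\delta}\colon\mathcal T\to C(n,\delta)$ is a bijection. For cubillages $\mathcal Q,\mathcal Q'$ of $Z(n,\delta+1)$ write $\mathcal Q\lessdot\mathcal Q'$, and call $\mathcal Q'$ an increasing flip of $\mathcal Q$, if there is a $(\delta+2)$-face $\Gamma$ of $Z(n,n)$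 such that $\mathcal Q\setminus\Gamma=\mathcal Q'\setminus\Gamma$, the set $\pi_{n,\delta+2}(\mathcal Q)$ contains the lower facets of $\pi_{n,\delta+2}(\Gamma)$, and $\pi_{n,\delta+2}(\mathcal Q')$ contains its upper facets. For triangulations $\mathcal T,\mathcal T'$ of $C(n,\delta)$ write $\mathcal T\lessdot\mathcal T'$, and call $\mathcal T'$ an increasing flip of $\mathcal T$, if there is a $(\delta+1)$-face $\Sigma$ of $C(n,n-1)$ such that $\mathcal T\setminus\Sigma=\mathcal T'\setminus\Sigma$, the set $\pi_{n-1,\delta+1}(\mathcal T)$ contains the lower facets of $\pi_{n-1,\delta+1}(\Sigma)$, and $\pi_{n-1,\delta+1}(\mathcal T')$ contains its upper facets. Here a facet is lower (upper) if its outer normal has negative (positive) last coordinate. The higher Bruhat order $\mathcal B(n,\delta+1)$ is the set of cubillages of $Z(n,\delta+1)$, and the first higher Stasheff–Tamari order $\mathcal S(n,\delta)$ is the set of triangulations of $C(n,\delta)$, each ordered by the reflexive-transitive closure of its relation $\lessdot$. Let $H_n=\{x\in\mathbb R^n : x_1=1\}$, identified with $\mathbb R^{n-1}$ by forgetting the first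 coordinate, and let $g\colon\mathcal B(n,\delta+1)\to\mathcal S(n,\delta)$ be the map $g(\mathcal Q)=\mathcal Q\cap H_n$. Then for all cubillages $\mathcal Q,\mathcal Q'$ of $Z(n,\delta+1)$ with $\mathcal Q\lessdot\mathcal Q'$, either $g(\mathcal Q)=g(\mathcal Q')$ or $g(\mathcal Q)\lessdot g(\mathcal Q')$. Consequently $g$ is order-preserving: if $\mathcal Q\le\mathcal Q'$ in $\mathcal B(n,\delta+1)$, then $g(\mathcal Q)\le g(\mathcal Q')$ in $\mathcal S(n,\delta)$. -/

import Mathlib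

open scoped Pointwise

noncomputable section

namespace CyclicGeometry

/-! Real `k`-space is `Fin k → ℝ`; the paper coordinate `x_{i+1}` is `x i`.
The label `j ∈ {1, …, n}` is the element `j - 1` of `Fin n`, so that the chosen parameter
`t_j = j` becomes `(i : ℝ) + 1` for `i : Fin n`. -/

/-- The canonical projection `π_{k,l}` onto the first `l` coordinates. -/
def proj {k l : ℕ} (h : l ≤ k) (x : Fin k → ℝ) : Fin l → ℝ :=
  fun i => x (Fin.castLE h i)

/-- The Veronese curve `ξ_t = (1, t, …, t^(k-1))` in `k`-space. -/
def veronese (k : ℕ) (t : ℝ) : Fin k → ℝ := fun i => t ^ (i : ℕ)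

/-- The moment curve `p_t = (t, t^2, …, t^k)` in `k`-space. -/
def moment (k : ℕ) (t : ℝ) : Fin k → ℝ := fun i => t ^ ((i : ℕ) + 1)

/-- The cyclic zonotope `Z(n,k)`: the Minkowski sum of the segments from `0` to `ξ_1, …, ξ_n`. -/
def cyclicZonotope (n k : ℕ) : Set (Fin k → ℝ) :=
  ∑ i : Fin n, segment ℝ (0 : Fin k → ℝ) (veronese k ((i : ℝ) + 1))

/-- The cyclic polytope `C(n,k)`: the convex hull of `p_1, …, p_n`. -/
def cyclicPolytope (n k : ℕ) : Set (Fin k → ℝ) :=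
  convexHull ℝ (Set.range fun i : Fin n => moment k ((i : ℝ) + 1))

/-- `F` is a `d`-face (nonempty face of dimension `d`) of the polytope `P`. The faces of a polytope
are its exposed subsets: the sets of maximisers of a linear functional. -/
def IsFaceOfDim {N : ℕ} (P F : Set (Fin N → ℝ)) (d : ℕ) : Prop :=
  IsExposed ℝ P F ∧ F.Nonempty ∧ Module.finrank ℝ (vectorSpan ℝ F) = d

/-- A subcomplex of a polytope `P`: a union of faces of `P`. -/
def IsSubcomplex {N : ℕ} (P S : Set (Fin N → ℝ)) : Prop :=
  ∃ 𝓕 : Set (Set (Fin N → ℝ)), (∀ F ∈ 𝓕, IsExposed ℝ P F) ∧ S = ⋃₀ 𝓕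

/-- `F` is a lower facet of the full-dimensional polytope `P` in `(k+1)`-space: a face of
codimension one with an outer normal whose last coordinate is negative. -/
def IsLowerFacet {k : ℕ} (P F : Set (Fin (k + 1) → ℝ)) : Prop :=
  IsFaceOfDim P F k ∧ ∃ l : (Fin (k + 1) → ℝ) →L[ℝ] ℝ,
    l (Pi.single (Fin.last k) 1) < 0 ∧ F = l.toExposed P

/-- `F` is an upper facet of the full-dimensional polytope `P` in `(k+1)`-space: a face of
codimension one with an outer normal whose last coordinate is positive. -/
def IsUpperFacet {k : ℕ} (P F : Set (Fin (k + 1) → ℝ)) : Prop :=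
  IsFaceOfDim P F k ∧ ∃ l : (Fin (k + 1) → ℝ) →L[ℝ] ℝ,
    0 < l (Pi.single (Fin.last k) 1) ∧ F = l.toExposed P

/-- For two subcomplexes `S`, `S'` of a polytope `P` in `N`-space, of dimension `k`: there is a
`(k+1)`-face `Γ` of `P` such that `S` and `S'` agree outside `Γ`, the projection of `S` to
`(k+1)`-space contains the lower facets of the projection of `Γ`, and the projection of `S'`
contains the upper facets. -/
def IsFlip {N : ℕ} (P : Set (Fin N → ℝ)) (k : ℕ) (S S' : Set (Fin N → ℝ)) : Prop :=
  ∃ (h : k + 1 ≤ N) (Γ : Set (Fin N → ℝ)), IsFaceOfDim P Γ (k + 1) ∧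
    S \ Γ = S' \ Γ ∧
    (∀ F, IsLowerFacet (proj h '' Γ) F → F ⊆ proj h '' S) ∧
    (∀ F, IsUpperFacet (proj h '' Γ) F → F ⊆ proj h '' S')

/-- A cubillage of `Z(n,k)`: a subcomplex of `Z(n,n)` that `π_{n,k}` maps bijectively
to `Z(n,k)`. -/
@[ext]
structure Cubillage (n k : ℕ) where
  carrier : Set (Fin n → ℝ)
  isSubcomplex : IsSubcomplex (cyclicZonotope n n) carrier
  le : k ≤ n
  bijOn : Set.BijOn (proj le) carrier (cyclicZonotope n k)

/-- A triangulation of `C(n,k)`: a subcomplex of `C(n,n-1)` that `π_{n-1,k}` maps bijectively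
to `C(n,k)`. -/
@[ext]
structure Triangulation (n k : ℕ) where
  carrier : Set (Fin (n - 1) → ℝ)
  isSubcomplex : IsSubcomplex (cyclicPolytope n (n - 1)) carrier
  le : k ≤ n - 1
  bijOn : Set.BijOn (proj le) carrier (cyclicPolytope n k)

/-- `Q'` is an increasing flip of the cubillage `Q`: the relation `Q ⋖ Q'` which generates the
higher Bruhat order. -/
def Cubillage.IncreasingFlip {n k : ℕ} (Q Q' : Cubillage n k) : Prop :=
  IsFlip (cyclicZonotope n n) k Q.carrier Q'.carrier

/-- `T'` is an increasing flip of the triangulation `T`: the relation `T ⋖ T'` which generates the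
first higher Stasheff--Tamari order. -/
def Triangulation.IncreasingFlip {n k : ℕ} (T T' : Triangulation n k) : Prop :=
  IsFlip (cyclicPolytope n (n - 1)) k T.carrier T'.carrier

/-- The higher Bruhat order on `B(n,k)`, the set of cubillages of `Z(n,k)`: the reflexive-transitive
closure of the increasing flips. -/
instance {n k : ℕ} : Preorder (Cubillage n k) where
  le := Relation.ReflTransGen Cubillage.IncreasingFlip
  le_refl _ := Relation.ReflTransGen.refl
  le_trans _ _ _ := Relation.ReflTransGen.trans

/-- The first higher Stasheff--Tamari order on `S(n,k)`, the set of triangulations of `C(n,k)`: the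
reflexive-transitive closure of the increasing flips. -/
instance {n k : ℕ} : Preorder (Triangulation n k) where
  le := Relation.ReflTransGen Triangulation.IncreasingFlip
  le_refl _ := Relation.ReflTransGen.refl
  le_trans _ _ _ := Relation.ReflTransGen.trans

/-- The hyperplane `H_k`, where the first coordinate is `1` (used for `k ≥ 1`). -/
def hyperplane (k : ℕ) : Set (Fin k → ℝ) := {x | ∀ i : Fin k, (i : ℕ) = 0 → x i = 1}

/-- Forgetting the first coordinate; its restriction to `H_k` is the identification of `H_k` with
`(k-1)`-space. -/
def dropFirst {k : ℕ} (x : Fin k → ℝ) : Fin (k - 1) → ℝ :=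
  fun i => x ⟨(i : ℕ) + 1, by omega⟩

/-- The intersection with `H_k`, as a subset of `(k-1)`-space. -/
def slice {k : ℕ} (S : Set (Fin k → ℝ)) : Set (Fin (k - 1) → ℝ) :=
  dropFirst '' (S ∩ hyperplane k)

theorem mem_cyclicZonotope {n k : ℕ} {x : Fin k → ℝ} :
    x ∈ cyclicZonotope n k ↔ ∃ c : Fin n → ℝ, (∀ i, 0 ≤ c i ∧ c i ≤ 1) ∧
      x = ∑ i, c i • veronese k ((i : ℝ) + 1) := by
  unfold cyclicZonotope
  rw [Set.mem_fintype_sum]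
  simp only [segment_eq_image, Set.mem_image, smul_zero, zero_add]
  constructor
  · rintro ⟨f, hf, rfl⟩
    choose c hc hcf using hf
    exact ⟨c, fun i => hc i, by simp [hcf]⟩
  · rintro ⟨c, hc, rfl⟩
    exact ⟨_, fun i => ⟨c i, hc i, rfl⟩, rfl⟩

theorem mem_cyclicPolytope {n k : ℕ} {x : Fin k → ℝ} :
    x ∈ cyclicPolytope n k ↔ ∃ c : Fin n → ℝ, (∀ i, 0 ≤ c i) ∧ ∑ i, c i = 1 ∧
      x = ∑ i, c i • moment k ((i : ℝ) + 1) := by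
  constructor
  · intro hx
    refine convexHull_min (t := {x | ∃ c : Fin n → ℝ, (∀ i, 0 ≤ c i) ∧ ∑ i, c i = 1 ∧
      x = ∑ i, c i • moment k ((i : ℝ) + 1)}) ?_ ?_ hx
    · rintro _ ⟨i, rfl⟩
      refine ⟨Pi.single i 1, fun j => ?_, by simp, ?_⟩
      · by_cases h : j = i
        · subst h; simp
        · simp [h]
      · simp [Pi.single_apply]
    · rintro _ ⟨c, hc, hc1, rfl⟩ _ ⟨d, hd, hd1, rfl⟩ a b ha hb hab
      refine ⟨fun i => a * c i + b * d i, fun i => ?_, ?_, ?_⟩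
      · have := hc i; have := hd i; positivity
      · rw [Finset.sum_add_distrib, ← Finset.mul_sum, ← Finset.mul_sum, hc1, hd1]; linarith
      · simp only [add_smul, Finset.sum_add_distrib, Finset.smul_sum, mul_smul]
  · rintro ⟨c, hc, hc1, rfl⟩
    exact (convex_convexHull ℝ _).sum_mem (fun i _ => hc i) hc1
      (fun i _ => subset_convexHull ℝ _ ⟨i, rfl⟩)

/-- The section of the zonotope `Z(n,k+1)` by `H_{k+1}` is the cyclic polytope `C(n,k)`. -/
theorem slice_cyclicZonotope (n k : ℕ) :
    slice (cyclicZonotope n (k + 1)) = cyclicPolytope n k := by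
  ext y
  rw [mem_cyclicPolytope]
  constructor
  · rintro ⟨x, ⟨hx, hx1⟩, rfl⟩
    obtain ⟨c, hc, rfl⟩ := mem_cyclicZonotope.1 hx
    refine ⟨c, fun i => (hc i).1, ?_, ?_⟩
    · have := hx1 0 rfl
      simpa [veronese] using this
    · funext j
      simp [dropFirst, veronese, moment]
  · rintro ⟨c, hc, hc1, rfl⟩
    refine ⟨∑ i, c i • veronese (k + 1) ((i : ℝ) + 1), ⟨mem_cyclicZonotope.2 ⟨c, fun i =>
      ⟨hc i, ?_⟩, rfl⟩, ?_⟩, ?_⟩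
    · rw [← hc1]
      exact Finset.single_le_sum (fun j _ => hc j) (Finset.mem_univ i)
    · intro j hj
      simp [veronese, hj, hc1]
    · funext j
      simp [dropFirst, veronese, moment]

theorem dropFirst_injOn (k : ℕ) : Set.InjOn (dropFirst (k := k)) (hyperplane k) := by
  intro x hx y hy h
  funext i
  by_cases hi : (i : ℕ) = 0
  · rw [hx i hi, hy i hi]
  · have := congrFun h ⟨(i : ℕ) - 1, by omega⟩
    simp only [dropFirst] at this
    have e : (⟨(i : ℕ) - 1 + 1, by omega⟩ : Fin k) = i := Fin.ext (by simp; omega)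
    rwa [e] at this

/-- The section of a face of `P` by the hyperplane is a face of the section of `P`. -/
theorem isExposed_slice {m : ℕ} {P F : Set (Fin (m + 1) → ℝ)} (hF : IsExposed ℝ P F) :
    IsExposed ℝ (slice P) (slice F) := by
  rintro ⟨_, x₀, ⟨hx₀, hx₀1⟩, rfl⟩
  obtain ⟨l, rfl⟩ := hF ⟨x₀, hx₀⟩
  let ι : (Fin m → ℝ) →L[ℝ] (Fin (m + 1) → ℝ) :=
    ContinuousLinearMap.pi (Fin.cases 0 fun i => ContinuousLinearMap.proj i)
  have key : ∀ x ∈ hyperplane (m + 1), x = ι (dropFirst x) + Pi.single 0 1 := by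
    intro x hx
    funext i
    refine Fin.cases ?_ (fun i => ?_) i
    · simp [ι, hx 0 rfl]
    · simp [ι, dropFirst, Fin.succ]
  have hl : ∀ x ∈ hyperplane (m + 1), l x = l (ι (dropFirst x)) + l (Pi.single 0 1) := by
    intro x hx
    conv_lhs => rw [key x hx]
    rw [map_add]
  refine ⟨l.comp ι, ?_⟩
  ext y
  constructor
  · rintro ⟨x, ⟨⟨hxP, hxm⟩, hx1⟩, rfl⟩
    refine ⟨⟨x, ⟨hxP, hx1⟩, rfl⟩, ?_⟩
    rintro _ ⟨z, ⟨hz, hz1⟩, rfl⟩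
    have := hxm z hz
    rw [hl x hx1, hl z hz1] at this
    simpa using this
  · rintro ⟨⟨x, ⟨hxP, hx1⟩, rfl⟩, hmax⟩
    refine ⟨x, ⟨⟨hxP, fun z hz => ?_⟩, hx1⟩, rfl⟩
    have h1 := hmax (dropFirst x₀) ⟨x₀, ⟨hx₀.1, hx₀1⟩, rfl⟩
    have h2 := hx₀.2 z hz
    rw [hl x₀ hx₀1] at h2
    rw [hl x hx1]
    simp only [ContinuousLinearMap.comp_apply] at h1
    linarith

theorem bijOn_slice {m k : ℕ} (h : k + 1 ≤ m + 1) (h' : k ≤ m) {S : Set (Fin (m + 1) → ℝ)}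
    {P : Set (Fin (k + 1) → ℝ)} (hS : Set.BijOn (proj h) S P) :
    Set.BijOn (proj h' : (Fin m → ℝ) → _) (slice S) (slice P) := by
  have hH : ∀ x : Fin (m + 1) → ℝ, proj h x ∈ hyperplane (k + 1) ↔ x ∈ hyperplane (m + 1) := by
    intro x
    have e : ∀ j, ∀ y : Fin (j + 1) → ℝ, y ∈ hyperplane (j + 1) ↔ y 0 = 1 := fun j y =>
      ⟨fun hy => hy 0 rfl, fun hy i hi => by rwa [show i = 0 from Fin.ext hi]⟩
    rw [e, e]
    rfl
  refine ⟨?_, ?_, ?_⟩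
  · rintro _ ⟨x, ⟨hx, hx1⟩, rfl⟩
    exact ⟨proj h x, ⟨hS.mapsTo hx, (hH x).2 hx1⟩, rfl⟩
  · rintro _ ⟨x, ⟨hx, hx1⟩, rfl⟩ _ ⟨z, ⟨hz, hz1⟩, rfl⟩ hxz
    have : proj h x = proj h z := dropFirst_injOn (k + 1) ((hH x).2 hx1) ((hH z).2 hz1) hxz
    rw [hS.injOn hx hz this]
  · rintro _ ⟨y, ⟨hy, hy1⟩, rfl⟩
    obtain ⟨x, hx, rfl⟩ := hS.surjOn hy
    exact ⟨dropFirst x, ⟨x, ⟨hx, (hH x).1 hy1⟩, rfl⟩, rfl⟩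

/-- The map `g` from `B(n,δ+1)` to `S(n,δ)`, sending `Q` to its vertex figure `Q ∩ H_n`. -/
def g {n δ : ℕ} (Q : Cubillage n (δ + 1)) : Triangulation n δ where
  carrier := slice Q.carrier
  isSubcomplex := by
    obtain ⟨Q, ⟨𝓕, h𝓕, rfl⟩, hle, hb⟩ := Q
    obtain ⟨m, rfl⟩ : ∃ m, n = m + 1 := ⟨n - 1, by omega⟩
    refine ⟨slice '' 𝓕, ?_, ?_⟩
    · rintro _ ⟨F, hF, rfl⟩
      have := isExposed_slice (h𝓕 F hF)
      rwa [slice_cyclicZonotope] at this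
    · ext y
      simp only [slice, Set.mem_image, Set.mem_inter_iff, Set.mem_sUnion, exists_exists_and_eq_and]
      aesop
  le := by have := Q.le; omega
  bijOn := by
    obtain ⟨Q, hc, hle, hb⟩ := Q
    obtain ⟨m, rfl⟩ : ∃ m, n = m + 1 := ⟨n - 1, by omega⟩
    have := bijOn_slice hle (by omega) hb
    rwa [slice_cyclicZonotope] at this

end CyclicGeometry

end

noncomputable section

namespace CyclicGeometry

/-! Let `Γ` be the face of Z(n,n) carrying the flip, cut out by a functional `l`. A point of Z(n,n)
is ∑ c_j ξ_j with c_j in [0,1], and its first coordinate is ∑ c_j.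

If l(ξ_i) > 0 for some i, maximality forces c_i = 1 on `Γ`, so `Γ` meets the hyperplane ∑ c_j = 1 at
most in ξ_i. The two triangulations then agree off a point, and bijectivity of the projection makes
them equal.

Otherwise l ≤ 0 on Z(n,n), and `Γ` is its zero set there: it contains 0 and is conic over its
section (`subsingleton_slice_or_isConicOver`). The section is then a face of dimension one less. A
facet of the projected section is cut out by an affine function; homogenizing it gives a facet of
the projected `Γ` with the same last normal coordinate (`IsConicOver.exists_facet`). So lower and
upper facets are inherited, and slicing yields a flip of triangulations. -/

theorem mem_hyperplane_succ {k : ℕ} {x : Fin (k + 1) → ℝ} : x ∈ hyperplane (k + 1) ↔ x 0 = 1 :=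
  ⟨fun hx => hx 0 rfl, fun hx i hi => by rwa [show i = 0 from Fin.ext hi]⟩

theorem proj_mem_hyperplane_iff {m k : ℕ} (h : k + 1 ≤ m + 1) {x : Fin (m + 1) → ℝ} :
    proj h x ∈ hyperplane (k + 1) ↔ x ∈ hyperplane (m + 1) := by
  rw [mem_hyperplane_succ, mem_hyperplane_succ]
  rfl

theorem slice_mono {k : ℕ} {S T : Set (Fin k → ℝ)} (h : S ⊆ T) : slice S ⊆ slice T :=
  Set.image_mono (Set.inter_subset_inter_left _ h)

/-- Holds because `dropFirst` is injective on the hyperplane. -/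
theorem slice_diff {k : ℕ} (S T : Set (Fin k → ℝ)) : slice (S \ T) = slice S \ slice T := by
  ext y
  constructor
  · rintro ⟨x, ⟨⟨hS, hT⟩, hx⟩, rfl⟩
    refine ⟨⟨x, ⟨hS, hx⟩, rfl⟩, ?_⟩
    rintro ⟨z, ⟨hzT, hz⟩, hzx⟩
    exact hT (dropFirst_injOn k hz hx hzx ▸ hzT)
  · rintro ⟨⟨x, ⟨hS, hx⟩, rfl⟩, hT⟩
    exact ⟨x, ⟨⟨hS, fun h => hT ⟨x, ⟨h, hx⟩, rfl⟩⟩, hx⟩, rfl⟩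

/-- Slicing by the hyperplane commutes with projecting to the first coordinates. -/
theorem slice_image_proj {m k : ℕ} (h : k + 1 ≤ m + 1) (h' : k ≤ m) (S : Set (Fin (m + 1) → ℝ)) :
    slice (proj h '' S) = (proj h' : (Fin m → ℝ) → _) '' slice S := by
  ext y
  constructor
  · rintro ⟨_, ⟨⟨x, hx, rfl⟩, hx1⟩, rfl⟩
    exact ⟨dropFirst x, ⟨x, ⟨hx, (proj_mem_hyperplane_iff h).1 hx1⟩, rfl⟩, rfl⟩
  · rintro ⟨_, ⟨x, ⟨hx, hx1⟩, rfl⟩, rfl⟩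
    exact ⟨proj h x, ⟨⟨x, hx, rfl⟩, (proj_mem_hyperplane_iff h).2 hx1⟩, rfl⟩

/-- `dropFirst` as a linear map. -/
def dropFirstₗ (k : ℕ) : (Fin (k + 1) → ℝ) →ₗ[ℝ] (Fin k → ℝ) where
  toFun := dropFirst
  map_add' _ _ := rfl
  map_smul' _ _ := rfl

/-- The linear span of a subset of the hyperplane has one dimension more than its affine span. -/
theorem finrank_span_eq_finrank_vectorSpan_dropFirst_add_one {k : ℕ} {G : Set (Fin (k + 1) → ℝ)}
    (hG : G ⊆ hyperplane (k + 1)) (hne : G.Nonempty) :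
    Module.finrank ℝ (Submodule.span ℝ G) =
      Module.finrank ℝ (vectorSpan ℝ (dropFirst '' G : Set (Fin k → ℝ))) + 1 := by
  obtain ⟨x₀, hx₀⟩ := hne
  have hx₀1 : x₀ 0 = 1 := mem_hyperplane_succ.1 (hG hx₀)
  -- Directions inside the hyperplane have first coordinate 0. Hence `dropFirst` loses no dimension
  -- on them, and `x₀`, with first coordinate 1, is independent of them.
  have hV0 : vectorSpan ℝ G ≤ LinearMap.ker (LinearMap.proj (R := ℝ) (φ := fun _ => ℝ) 0) := by
    rw [vectorSpan_def, Submodule.span_le]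
    rintro _ ⟨x, hx, y, hy, rfl⟩
    simp [mem_hyperplane_succ.1 (hG hx), mem_hyperplane_succ.1 (hG hy)]
  have hmap : vectorSpan ℝ (dropFirst '' G : Set (Fin k → ℝ)) =
      (vectorSpan ℝ G).map (dropFirstₗ k) :=
    ((dropFirstₗ k).toAffineMap.map_vectorSpan (s := G)).symm
  have hinj : Set.InjOn (dropFirstₗ k) (vectorSpan ℝ G) := by
    intro x hx y hy hxy
    funext i
    refine Fin.cases ?_ (fun i => congrFun hxy i) i
    exact (hV0 hx).trans (hV0 hy).symm
  have hfin : Module.finrank ℝ (vectorSpan ℝ (dropFirst '' G : Set (Fin k → ℝ))) =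
      Module.finrank ℝ (vectorSpan ℝ G) := by
    rw [hmap]
    have := LinearMap.finrank_range_of_inj (f := (dropFirstₗ k).domRestrict (vectorSpan ℝ G))
      (fun x y hxy => Subtype.ext (hinj x.2 y.2 hxy))
    rwa [LinearMap.range_domRestrict] at this
  have hspan : Submodule.span ℝ G = vectorSpan ℝ G ⊔ Submodule.span ℝ {x₀} := by
    apply le_antisymm
    · rw [Submodule.span_le]
      intro x hx
      rw [← sub_add_cancel x x₀]
      exact Submodule.add_mem_sup (vsub_mem_vectorSpan ℝ hx hx₀)
        (Submodule.mem_span_singleton_self x₀)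
    · refine sup_le ?_ (Submodule.span_mono (by simpa using hx₀))
      rw [vectorSpan_def, Submodule.span_le]
      rintro _ ⟨x, hx, y, hy, rfl⟩
      exact sub_mem (Submodule.subset_span hx) (Submodule.subset_span hy)
  have hdisj : vectorSpan ℝ G ⊓ Submodule.span ℝ {x₀} = ⊥ := by
    rw [eq_bot_iff]
    rintro x ⟨hx, hx'⟩
    obtain ⟨a, rfl⟩ := Submodule.mem_span_singleton.1 hx'
    have : a * x₀ 0 = 0 := hV0 hx
    have : a = 0 := by simpa [hx₀1] using this
    simp [this]
  have := Submodule.finrank_sup_add_finrank_inf_eq (vectorSpan ℝ G) (Submodule.span ℝ {x₀})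
  rw [hdisj, ← hspan, finrank_bot, finrank_span_singleton (fun h => by simp [h] at hx₀1)] at this
  omega

/-! ### Sets conic over their section, and their facets -/

/-- Every point of `P` is a nonnegative multiple of a point of `P` in the hyperplane. -/
def IsConicOver {k : ℕ} (P : Set (Fin k → ℝ)) : Prop :=
  ∀ x ∈ P, ∃ a : ℝ, 0 ≤ a ∧ ∃ y ∈ P ∩ hyperplane k, x = a • y

theorem IsConicOver.image_proj {m k : ℕ} (h : k + 1 ≤ m + 1) {P : Set (Fin (m + 1) → ℝ)}
    (hP : IsConicOver P) : IsConicOver (proj h '' P) := by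
  rintro _ ⟨x, hx, rfl⟩
  obtain ⟨a, ha, y, ⟨hy, hy1⟩, rfl⟩ := hP x hx
  exact ⟨a, ha, proj h y, ⟨⟨y, hy, rfl⟩, (proj_mem_hyperplane_iff h).2 hy1⟩, rfl⟩

/-- Conicity supplies a point of the section even when the multiple is 0. -/
theorem IsConicOver.slice_nonempty {k : ℕ} {P : Set (Fin k → ℝ)} (hP : IsConicOver P)
    (hne : P.Nonempty) : (slice P).Nonempty := by
  obtain ⟨x, hx⟩ := hne
  obtain ⟨_, -, y, hy, -⟩ := hP x hx
  exact ⟨_, y, hy, rfl⟩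

theorem vectorSpan_eq_span_of_zero_mem {k : ℕ} {P : Set (Fin k → ℝ)} (h0 : (0 : Fin k → ℝ) ∈ P) :
    vectorSpan ℝ P = Submodule.span ℝ P := by
  rw [vectorSpan_eq_span_vsub_set_right ℝ h0]
  simp

/-- As 0 lies in `P`, its direction space is its linear span, and by conicity the section already
spans it. -/
theorem IsConicOver.finrank_vectorSpan_slice {k : ℕ} {P : Set (Fin (k + 1) → ℝ)}
    (hP : IsConicOver P) (h0 : (0 : Fin (k + 1) → ℝ) ∈ P) :
    Module.finrank ℝ (vectorSpan ℝ P) =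
      Module.finrank ℝ (vectorSpan ℝ (slice P : Set (Fin k → ℝ))) + 1 := by
  have hspan : Submodule.span ℝ P = Submodule.span ℝ (P ∩ hyperplane (k + 1)) := by
    refine le_antisymm (Submodule.span_le.2 fun x hx => ?_)
      (Submodule.span_mono Set.inter_subset_left)
    obtain ⟨a, -, y, hy, rfl⟩ := hP x hx
    exact Submodule.smul_mem _ _ (Submodule.subset_span hy)
  rw [vectorSpan_eq_span_of_zero_mem h0, hspan]
  exact finrank_span_eq_finrank_vectorSpan_dropFirst_add_one Set.inter_subset_right
    (Set.image_nonempty.1 (hP.slice_nonempty ⟨0, h0⟩))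

/-- A facet of the slice of a conic polytope is contained in the slice of a facet, with an outer
normal that has the same last coordinate. -/
theorem IsConicOver.exists_facet {k : ℕ} {P : Set (Fin (k + 2) → ℝ)} (hP : IsConicOver P)
    (h0 : (0 : Fin (k + 2) → ℝ) ∈ P) {F : Set (Fin (k + 1) → ℝ)}
    (hF : IsFaceOfDim (slice P : Set (Fin (k + 1) → ℝ)) F k) {l : (Fin (k + 1) → ℝ) →L[ℝ] ℝ}
    (hl : F = l.toExposed (slice P : Set (Fin (k + 1) → ℝ)))
    (hl0 : l (Pi.single (Fin.last k) 1) ≠ 0) :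
    ∃ (F' : Set (Fin (k + 2) → ℝ)) (L : (Fin (k + 2) → ℝ) →L[ℝ] ℝ),
      IsFaceOfDim P F' (k + 1) ∧ F' = L.toExposed P ∧
      L (Pi.single (Fin.last (k + 1)) 1) = l (Pi.single (Fin.last k) 1) ∧ F ⊆ slice F' := by
  obtain ⟨-, ⟨f, hf⟩, hdim⟩ := hF
  -- Homogenization of `l - l f`, where `l f` is the maximum of `l` on the section: `L` is at most 0
  -- on the section, hence on `P` by conicity.
  let L : (Fin (k + 2) → ℝ) →L[ℝ] ℝ :=
    l.comp (LinearMap.toContinuousLinearMap (dropFirstₗ (k + 1))) -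
      l f • ContinuousLinearMap.proj (R := ℝ) (φ := fun _ => ℝ) 0
  have hL : ∀ x, L x = l (dropFirst x) - l f * x 0 := fun x => rfl
  have hLH : ∀ x ∈ P ∩ hyperplane (k + 2), L x ≤ 0 := by
    rintro x ⟨hx, hx1⟩
    rw [hl] at hf
    have := hf.2 (dropFirst x) ⟨x, ⟨hx, hx1⟩, rfl⟩
    rw [hL, mem_hyperplane_succ.1 hx1]
    linarith
  have hLP : ∀ x ∈ P, L x ≤ 0 := by
    intro x hx
    obtain ⟨a, ha, y, hy, rfl⟩ := hP x hx
    rw [map_smul, smul_eq_mul]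
    exact mul_nonpos_of_nonneg_of_nonpos ha (hLH y hy)
  have hmem : ∀ x, x ∈ L.toExposed P ↔ x ∈ P ∧ L x = 0 := by
    intro x
    constructor
    · rintro ⟨hx, hmax⟩
      exact ⟨hx, le_antisymm (hLP x hx) (by simpa using hmax 0 h0)⟩
    · rintro ⟨hx, hx0⟩
      exact ⟨hx, fun y hy => hx0 ▸ hLP y hy⟩
  have h0' : (0 : Fin (k + 2) → ℝ) ∈ L.toExposed P := (hmem 0).2 ⟨h0, map_zero L⟩
  have hFs : F = slice (L.toExposed P) := by
    ext y
    constructor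
    · intro hy
      have hy' := hy
      rw [hl] at hy' hf
      obtain ⟨⟨x, ⟨hx, hx1⟩, rfl⟩, hmax⟩ := hy'
      refine ⟨x, ⟨(hmem x).2 ⟨hx, ?_⟩, hx1⟩, rfl⟩
      have h1 := hmax f hf.1
      have h2 := hLH x ⟨hx, hx1⟩
      rw [hL, mem_hyperplane_succ.1 hx1] at h2 ⊢
      linarith
    · rintro ⟨x, ⟨hx, hx1⟩, rfl⟩
      obtain ⟨hxP, hx0⟩ := (hmem x).1 hx
      rw [hL, mem_hyperplane_succ.1 hx1] at hx0
      rw [hl] at hf ⊢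
      refine ⟨⟨x, ⟨hxP, hx1⟩, rfl⟩, fun z hz => (hf.2 z hz).trans (by linarith)⟩
  have hLlast : L (Pi.single (Fin.last (k + 1)) 1) = l (Pi.single (Fin.last k) 1) := by
    have e : (dropFirst (Pi.single (Fin.last (k + 1)) 1 : Fin (k + 2) → ℝ) : Fin (k + 1) → ℝ) =
        Pi.single (Fin.last k) 1 := by
      funext i
      simp [dropFirst, Pi.single_apply, Fin.ext_iff]
    rw [hL]
    erw [e]
    simp [Fin.ext_iff]
  refine ⟨L.toExposed P, L, ⟨ContinuousLinearMap.toExposed.isExposed, ⟨0, h0'⟩, le_antisymm ?_ ?_⟩, rfl, hLlast,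
    hFs.le⟩
  · have hker : vectorSpan ℝ (L.toExposed P) ≤ LinearMap.ker L.toLinearMap := by
      rw [vectorSpan_eq_span_of_zero_mem h0', Submodule.span_le]
      exact fun x hx => ((hmem x).1 hx).2
    have hne : LinearMap.ker L.toLinearMap ≠ ⊤ := by
      intro h
      have : Pi.single (Fin.last (k + 1)) 1 ∈ LinearMap.ker L.toLinearMap := h ▸ trivial
      exact hl0 (hLlast ▸ this)
    have := Submodule.finrank_lt hne
    rw [Module.finrank_fin_fun] at this
    have := Submodule.finrank_mono hker
    omega
  · have hne : (L.toExposed P ∩ hyperplane (k + 2)).Nonempty := by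
      rw [hFs] at hf
      exact Set.image_nonempty.1 ⟨f, hf⟩
    have := finrank_span_eq_finrank_vectorSpan_dropFirst_add_one
      (Set.inter_subset_right (s := L.toExposed P)) hne
    rw [hFs] at hdim
    rw [vectorSpan_eq_span_of_zero_mem h0']
    exact (congrArg (· + 1) hdim.symm).le.trans <| this.ge.trans (Submodule.finrank_mono (Submodule.span_mono Set.inter_subset_left))

/-! ### Sections of faces of the zonotope -/

/-- A face of `Z(n,n)` either meets the hyperplane in at most one point or is conic over its
intersection with the hyperplane. -/
theorem subsingleton_slice_or_isConicOver {m d : ℕ} {Γ : Set (Fin (m + 1) → ℝ)}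
    (hΓ : IsFaceOfDim (cyclicZonotope (m + 1) (m + 1)) Γ (d + 1)) :
    (slice Γ).Subsingleton ∨ (0 : Fin (m + 1) → ℝ) ∈ Γ ∧ IsConicOver Γ := by
  obtain ⟨hexp, hne, hdim⟩ := hΓ
  obtain ⟨l, hl⟩ := hexp hne
  set ξ : Fin (m + 1) → Fin (m + 1) → ℝ := fun i => veronese (m + 1) ((i : ℝ) + 1) with hξ
  have hξ0 : ∀ c : Fin (m + 1) → ℝ, (∑ i, c i • ξ i) 0 = ∑ i, c i := fun c => by
    simp [hξ, veronese]
  by_cases hpos : ∃ i, 0 < l (ξ i)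
  · left
    obtain ⟨i, hi⟩ := hpos
    have hsub : Γ ∩ hyperplane (m + 1) ⊆ {ξ i} := by
      rintro x ⟨hx, hx1⟩
      rw [hl] at hx
      obtain ⟨hxZ, hmax⟩ := hx
      obtain ⟨c, hc, hxc⟩ := mem_cyclicZonotope.1 hxZ
      change x = ∑ j, c j • ξ j at hxc
      -- Raising `c i` to 1 stays in the zonotope and adds `(1 - c i) * l (ξ i)` to `l`.
      have hci : c i = 1 := by
        have hy : x + (1 - c i) • ξ i ∈ cyclicZonotope (m + 1) (m + 1) := by
          refine mem_cyclicZonotope.2 ⟨c + Pi.single i (1 - c i), fun j => ?_, ?_⟩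
          · rcases eq_or_ne j i with rfl | hj
            · simp
            · simpa [hj] using hc j
          · rw [hxc]
            simp [add_smul, Finset.sum_add_distrib, Pi.single_apply, hξ]
        have := hmax _ hy
        rw [map_add, map_smul, smul_eq_mul] at this
        have h2 := (hc i).2
        nlinarith
      have hsum : ∑ j, c j = 1 := by
        rw [← hξ0, ← hxc]
        exact mem_hyperplane_succ.1 hx1
      have hc0 : ∀ j ≠ i, c j = 0 := by
        rw [← Finset.add_sum_erase _ _ (Finset.mem_univ i), hci] at hsum
        have h0 : ∑ j ∈ Finset.univ.erase i, c j = 0 := by linarith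
        intro j hj
        exact (Finset.sum_eq_zero_iff_of_nonneg fun j _ => (hc j).1).1 h0 j (by simpa using hj)
      rw [hxc, Set.mem_singleton_iff, Finset.sum_eq_single i (fun j _ hj => by simp [hc0 j hj])
        (by simp), hci, one_smul]
    exact (Set.subsingleton_singleton.anti hsub).image _
  · right
    push Not at hpos
    have hle : ∀ x ∈ cyclicZonotope (m + 1) (m + 1), l x ≤ 0 := by
      intro x hx
      obtain ⟨c, hc, rfl⟩ := mem_cyclicZonotope.1 hx
      rw [map_sum]
      refine Finset.sum_nonpos fun i _ => ?_
      rw [map_smul]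
      exact mul_nonpos_of_nonneg_of_nonpos (hc i).1 (hpos i)
    have hZ0 : (0 : Fin (m + 1) → ℝ) ∈ cyclicZonotope (m + 1) (m + 1) :=
      mem_cyclicZonotope.2 ⟨0, by simp, by simp⟩
    have hmem : ∀ x, x ∈ Γ ↔ x ∈ cyclicZonotope (m + 1) (m + 1) ∧ l x = 0 := by
      intro x
      rw [hl]
      constructor
      · rintro ⟨hx, hmax⟩
        exact ⟨hx, le_antisymm (hle x hx) (by simpa using hmax 0 hZ0)⟩
      · rintro ⟨hx, hx0⟩
        exact ⟨hx, fun y hy => hx0 ▸ hle y hy⟩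
    have h0 : (0 : Fin (m + 1) → ℝ) ∈ Γ := (hmem 0).2 ⟨hZ0, map_zero l⟩
    -- Divide by the first coordinate ∑ c_j. The new coefficients stay at most 1 because each c_j is
    -- at most the sum.
    have hcone : ∀ x ∈ Γ, x ≠ 0 → ∃ a : ℝ, 0 ≤ a ∧ ∃ y ∈ Γ ∩ hyperplane (m + 1), x = a • y := by
      intro x hx hx0
      obtain ⟨hxZ, hlx⟩ := (hmem x).1 hx
      obtain ⟨c, hc, hxc⟩ := mem_cyclicZonotope.1 hxZ
      change x = ∑ j, c j • ξ j at hxc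
      have ha : 0 < ∑ j, c j := by
        refine (Finset.sum_nonneg fun j _ => (hc j).1).lt_of_ne' fun h => hx0 ?_
        have := (Finset.sum_eq_zero_iff_of_nonneg fun j _ => (hc j).1).1 h
        rw [hxc]
        exact Finset.sum_eq_zero fun j hj => by rw [this j hj, zero_smul]
      have hy : (∑ j, c j)⁻¹ • x = ∑ j, ((∑ j, c j)⁻¹ * c j) • ξ j := by
        rw [hxc, Finset.smul_sum]
        simp only [mul_smul]
      refine ⟨∑ j, c j, ha.le, (∑ j, c j)⁻¹ • x, ⟨(hmem _).2 ⟨mem_cyclicZonotope.2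
        ⟨_, fun j => ⟨?_, ?_⟩, hy⟩, ?_⟩, ?_⟩, (smul_inv_smul₀ ha.ne' x).symm⟩
      · exact mul_nonneg (inv_nonneg.2 ha.le) (hc j).1
      · rw [inv_mul_le_one₀ ha]
        exact Finset.single_le_sum (fun j _ => (hc j).1) (Finset.mem_univ j)
      · rw [map_smul, hlx, smul_zero]
      · rw [mem_hyperplane_succ, hy, hξ0, ← Finset.mul_sum, inv_mul_cancel₀ ha.ne']
    refine ⟨h0, fun x hx => ?_⟩
    by_cases hx0 : x = 0
    -- The origin is 0 times any point of the section; one exists since `Γ` has positive dimension.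
    · obtain ⟨z, hz, hz0⟩ : ∃ z ∈ Γ, z ≠ 0 := by
        by_contra! h
        have : Γ.Subsingleton := fun x hx y hy => (h x hx).trans (h y hy).symm
        rw [vectorSpan_of_subsingleton ℝ this, finrank_bot] at hdim
        omega
      obtain ⟨-, -, y, hy, -⟩ := hcone z hz hz0
      exact ⟨0, le_rfl, y, hy, by rw [hx0, zero_smul]⟩
    · exact hcone x hx hx0

/-! ### Flips under slicing -/

/-- Triangulations that agree outside of a point are equal. -/
theorem Triangulation.eq_of_diff_subsingleton {n k : ℕ} {T T' : Triangulation n k}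
    {A : Set (Fin (n - 1) → ℝ)} (hA : A.Subsingleton) (h : T.carrier \ A = T'.carrier \ A) :
    T = T' := by
  have key : ∀ {T T' : Triangulation n k}, T.carrier \ A = T'.carrier \ A →
      T.carrier ⊆ T'.carrier := by
    intro T T' h x hx
    by_contra hx'
    have hxA : x ∈ A := by
      by_contra hxA
      exact hx' ((h ▸ (⟨hx, hxA⟩ : x ∈ T.carrier \ A) : x ∈ T'.carrier \ A).1)
    -- The point `y` of `T'` over the image of `x` is not in `A`, whose only point is `x`. So `y`
    -- lies in `T` too, and injectivity gives `y = x`.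
    obtain ⟨y, hy, hyx⟩ := T'.bijOn.surjOn (T.bijOn.mapsTo hx)
    have hyA : y ∉ A := fun hyA => hx' (hA hxA hyA ▸ hy)
    have hyT : y ∈ T.carrier := (h ▸ (⟨hy, hyA⟩ : y ∈ T'.carrier \ A) : y ∈ T.carrier \ A).1
    exact hx' (T.bijOn.injOn hyT hx hyx ▸ hy)
  exact Triangulation.ext ((key h).antisymm (key h.symm))

theorem g_eq_or_increasingFlip {n δ : ℕ} {Q Q' : Cubillage n (δ + 1)} (h : Q.IncreasingFlip Q') :
    g Q = g Q' ∨ (g Q).IncreasingFlip (g Q') := by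
  obtain ⟨hle, Γ, hΓ, hdiff, hlow, hupp⟩ := h
  obtain ⟨m, rfl⟩ : ∃ m, n = m + 1 := ⟨n - 1, by omega⟩
  have hdiff' : (g Q).carrier \ slice Γ = (g Q').carrier \ slice Γ := by
    change slice _ \ _ = slice _ \ _
    rw [← slice_diff, hdiff, slice_diff]
  rcases subsingleton_slice_or_isConicOver hΓ with hs | ⟨h0, hcone⟩
  · exact Or.inl (Triangulation.eq_of_diff_subsingleton hs hdiff')
  right
  have hle' : δ + 1 ≤ m := by omega
  have hP : IsConicOver (proj hle '' Γ) := hcone.image_proj hle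
  have hP0 : (0 : Fin (δ + 2) → ℝ) ∈ proj hle '' Γ := ⟨0, h0, rfl⟩
  have hslice := slice_image_proj hle hle'
  refine ⟨hle', slice Γ, ⟨?_, hcone.slice_nonempty ⟨0, h0⟩, ?_⟩, hdiff', ?_, ?_⟩
  · have := isExposed_slice hΓ.1
    rwa [slice_cyclicZonotope] at this
  · have h1 := hcone.finrank_vectorSpan_slice h0
    rw [hΓ.2.2] at h1
    exact (Nat.succ_injective h1).symm
  · rintro F ⟨hF, l, hl, hFl⟩
    -- Read the facet of the projected section as a facet of the section of the projected `Γ`, so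
    -- that it extends to a facet of the latter.
    erw [← hslice] at hF hFl
    obtain ⟨F', L, hF', hL, hlast, hsub⟩ := hP.exists_facet hP0 hF hFl hl.ne
    exact (hsub.trans (slice_mono (hlow F' ⟨hF', L, hlast ▸ hl, hL⟩))).trans (hslice Q.carrier).le
  · rintro F ⟨hF, l, hl, hFl⟩
    erw [← hslice] at hF hFl
    obtain ⟨F', L, hF', hL, hlast, hsub⟩ := hP.exists_facet hP0 hF hFl hl.ne'
    exact (hsub.trans (slice_mono (hupp F' ⟨hF', L, hlast ▸ hl, hL⟩))).trans (hslice Q'.carrier).le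

end CyclicGeometry

end

theorem corollary4p3 (n δ : ℕ) (hn : δ + 1 ≤ n) :
    (∀ Q Q' : CyclicGeometry.Cubillage n (δ + 1), Q.IncreasingFlip Q' →
      CyclicGeometry.g Q = CyclicGeometry.g Q' ∨
        (CyclicGeometry.g Q).IncreasingFlip (CyclicGeometry.g Q')) ∧
    Monotone (CyclicGeometry.g : CyclicGeometry.Cubillage n (δ + 1) →
      CyclicGeometry.Triangulation n δ) := by
  refine ⟨fun _ _ => CyclicGeometry.g_eq_or_increasingFlip, fun Q Q' h => ?_⟩
  induction h with
  | refl => exact le_rfl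
  | tail _ hflip ih =>
    refine ih.trans ?_
    rcases CyclicGeometry.g_eq_or_increasingFlip hflip with h | h
    · exact h.le
    · exact Relation.ReflTransGen.single h
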